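/- Let $M$ be a matroid on a finite ground set $E(M)$, let $t\geq 1$ be an integer, and let $(S_e)_{e\in E(M)}$ be pairwise disjoint sets with $|S_e|=t$ for every $e\in E(M)$. For $A\subseteq E(M)$ put $S_A=\bigcup_{e\in A}S_e$. A *cyclic flat* of a matroid is a flat that is a (possibly empty) union of circuits. Let $M^t$ be the $t$-expansion of $M$, that is, the matroid on $S_{E(M)}$ whose cyclic flats are exactly the sets $S_A$ with $A$ a cyclic flat of $M$, and in which $r_{M^t}(S_A)=t\cdot r_M(A)$ for every cyclic flat $A$ of $M$. A *presentation* of a matroid $N$ is a finite sequence $(A_1,\dots,A_k)$, $k\geq 0$, of (not necessarily distinct or non-empty) subsets of $E(N)$ such that the independent sets of $N$ are exactly the partial transversals of the sequence, i.e. the sets $I$ for which there is an injection $\varphi:I\to\{1,\dots,k\}$ with $e\in A_{\varphi(e)}$ for all $e\in I$. The matroid $N$ is *transversal* if it has a presentation, and *fundamental* (or *principal*) *transversal* if it has a presentation in which every set $A_i$ contains an element that lies in no $A_j$ with $j\neq i$. Then $M$ is transversal if and only if $M^t$ is transversal. Furthermore, $M$ is fundamental transversal if and only if $M^t$ is fundamental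 transversal. -/

import Mathlib

open Set

namespace Matroid

universe u v

/-- A cyclic flat of a matroid: a flat that is a (possibly empty) union of circuits. -/
def IsCyclicFlat {α : Type u} (M : Matroid α) (X : Set α) : Prop :=
  M.IsFlat X ∧ ∃ C : Set (Set α), (∀ K ∈ C, M.IsCircuit K) ∧ X = ⋃₀ C

/-- `S_A`, the union of the sets `S e` over the elements `e` of `A`. -/
def blowUp {α : Type u} {β : Type v} (S : α → Set β) (A : Set α) : Set β := ⋃ e ∈ A, S e

/-- `N` is the `t`-expansion of `M` with respect to the sets `S e` (`e ∈ M.E`): these are pairwise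
disjoint `t`-element sets, `N` is a matroid on their union, the cyclic flats of `N` are exactly
the sets `S_A` for `A` a cyclic flat of `M`, and such a set `S_A` has rank `t * r_M(A)` in `N`. -/
structure IsTExpansion {α : Type u} {β : Type v} (M : Matroid α) (t : ℕ) (S : α → Set β)
    (N : Matroid β) : Prop where
  encard_eq : ∀ e ∈ M.E, (S e).encard = t
  disjoint : ∀ e ∈ M.E, ∀ f ∈ M.E, e ≠ f → Disjoint (S e) (S f)
  ground_eq : N.E = blowUp S M.E
  isCyclicFlat_iff : ∀ X, N.IsCyclicFlat X ↔ ∃ A, M.IsCyclicFlat A ∧ X = blowUp S A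
  eRk_eq : ∀ A, M.IsCyclicFlat A → N.eRk (blowUp S A) = t * M.eRk A

/-- `I` is a partial transversal of the set system `A 0, …, A (k - 1)` (repetitions and empty
sets are allowed): its elements can be matched injectively to indices `i` with `e ∈ A i`. -/
def IsPartialTransversal {α : Type u} {k : ℕ} (A : Fin k → Set α) (I : Set α) : Prop :=
  ∃ φ : I → Fin k, Function.Injective φ ∧ ∀ e : I, (e : α) ∈ A (φ e)

/-- The set system `A` of subsets of the ground set is a presentation of `M`: the independent sets
of `M` are precisely the partial transversals of `A`. -/
def IsPresentation {α : Type u} (M : Matroid α) {k : ℕ} (A : Fin k → Set α) : Prop :=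
  (∀ i, A i ⊆ M.E) ∧ ∀ I : Set α, M.Indep I ↔ IsPartialTransversal A I

/-- A matroid is transversal if it has a presentation by a finite set system. -/
def IsTransversal {α : Type u} (M : Matroid α) : Prop :=
  ∃ (k : ℕ) (A : Fin k → Set α), M.IsPresentation A

/-- A matroid is fundamental (or principal) transversal if it has a presentation by a finite set
system in which each set has an element that is in none of the other sets. -/
def IsFundamentalTransversal {α : Type u} (M : Matroid α) : Prop :=
  ∃ (k : ℕ) (A : Fin k → Set α), M.IsPresentation A ∧
    ∀ i, ∃ b ∈ A i, ∀ j, j ≠ i → b ∉ A j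

/-! The definition above is not empty: for a finite matroid, `t` and pairwise disjoint `t`-element
sets `S e` there is a `t`-expansion. -/

section Existence

variable {α : Type u} {β : Type v} {M : Matroid α} {t : ℕ} {S : α → Set β} {A B : Set α}

theorem mem_blowUp {x : β} : x ∈ blowUp S A ↔ ∃ e ∈ A, x ∈ S e := by simp [blowUp]

theorem blowUp_mono (h : A ⊆ B) : blowUp S A ⊆ blowUp S B := biUnion_subset_biUnion_left h

theorem blowUp_union : blowUp S (A ∪ B) = blowUp S A ∪ blowUp S B := biUnion_union _ _ _

theorem mem_blowUp_iff (hd : ∀ e ∈ M.E, ∀ f ∈ M.E, e ≠ f → Disjoint (S e) (S f))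
    (hA : A ⊆ M.E) {e : α} (he : e ∈ M.E) {x : β} (hx : x ∈ S e) : x ∈ blowUp S A ↔ e ∈ A := by
  rw [mem_blowUp]
  refine ⟨fun ⟨f, hf, hxf⟩ ↦ ?_, fun h ↦ ⟨e, h, hx⟩⟩
  by_contra hne
  exact (hd e he f (hA hf) (by rintro rfl; exact hne hf)).le_bot ⟨hx, hxf⟩

theorem blowUp_inter (hd : ∀ e ∈ M.E, ∀ f ∈ M.E, e ≠ f → Disjoint (S e) (S f))
    (hA : A ⊆ M.E) (hB : B ⊆ M.E) : blowUp S (A ∩ B) = blowUp S A ∩ blowUp S B := by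
  refine subset_antisymm (subset_inter (blowUp_mono inter_subset_left)
    (blowUp_mono inter_subset_right)) ?_
  rintro x ⟨hxA, hxB⟩
  obtain ⟨e, he, hx⟩ := mem_blowUp.1 hxA
  exact mem_blowUp.2 ⟨e, ⟨he, (mem_blowUp_iff hd hB (hA he) hx).1 hxB⟩, hx⟩

theorem encard_blowUp [M.Finite] (hS : ∀ e ∈ M.E, (S e).encard = t)
    (hd : ∀ e ∈ M.E, ∀ f ∈ M.E, e ≠ f → Disjoint (S e) (S f)) (hA : A ⊆ M.E) :
    (blowUp S A).encard = t * A.encard := by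
  have hfin : A.Finite := M.ground_finite.subset hA
  induction A, hfin using Set.Finite.induction_on with
  | empty => simp [blowUp]
  | @insert a s has _ ih =>
    have ha : a ∈ M.E := hA (mem_insert _ _)
    have hs : s ⊆ M.E := (subset_insert _ _).trans hA
    have h1 : blowUp S (insert a s) = S a ∪ blowUp S s := biUnion_insert _ _ _
    have h2 : Disjoint (S a) (blowUp S s) := by
      rw [Set.disjoint_left]
      exact fun x hx hxs ↦ has ((mem_blowUp_iff hd hs ha hx).1 hxs)
    rw [h1, encard_union_eq h2, ih hs, hS a ha, encard_insert_of_notMem has]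
    ring

/-- Independence in the `t`-expansion: `|I ∩ S_A| ≤ t * r(A)` for all sets `A`. -/
def ExpIndep (M : Matroid α) (t : ℕ) (S : α → Set β) (I : Set β) : Prop :=
  I ⊆ blowUp S M.E ∧ ∀ A ⊆ M.E, (I ∩ blowUp S A).encard ≤ t * M.eRk A

theorem blowUp_ground_finite [M.Finite] (hS : ∀ e ∈ M.E, (S e).encard = t) :
    (blowUp S M.E).Finite :=
  M.ground_finite.biUnion fun e he ↦ finite_of_encard_eq_coe (hS e he)

theorem eRk_ne_top' [M.Finite] (A : Set α) : (t : ℕ∞) * M.eRk A ≠ ⊤ :=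
  WithTop.mul_ne_top (ENat.natCast_ne_top t)
    (((M.eRk_le_eRank A).trans M.eRank_le_encard_ground).trans_lt
      M.ground_finite.encard_lt_top).ne

theorem ExpIndep.tight_union [M.Finite]
    (hd : ∀ e ∈ M.E, ∀ f ∈ M.E, e ≠ f → Disjoint (S e) (S f)) {I : Set β}
    (hI : ExpIndep M t S I) (hA : A ⊆ M.E) (hB : B ⊆ M.E)
    (tA : (t : ℕ∞) * M.eRk A ≤ (I ∩ blowUp S A).encard)
    (tB : (t : ℕ∞) * M.eRk B ≤ (I ∩ blowUp S B).encard) :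
    (t : ℕ∞) * M.eRk (A ∪ B) ≤ (I ∩ blowUp S (A ∪ B)).encard := by
  have hc : (I ∩ blowUp S (A ∪ B)).encard + (I ∩ blowUp S (A ∩ B)).encard =
      (I ∩ blowUp S A).encard + (I ∩ blowUp S B).encard := by
    rw [blowUp_union, blowUp_inter hd hA hB, inter_union_distrib_left, inter_inter_distrib_left,
      encard_union_add_encard_inter]
  have h1 := hI.2 (A ∩ B) (inter_subset_left.trans hA)
  have h2 : (t : ℕ∞) * M.eRk (A ∩ B) + t * M.eRk (A ∪ B) ≤ t * M.eRk A + t * M.eRk B := by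
    rw [← mul_add, ← mul_add]
    exact mul_le_mul_right (M.eRk_inter_add_eRk_union_le A B) _
  have h3 : (t : ℕ∞) * M.eRk (A ∩ B) + t * M.eRk (A ∪ B) ≤
      t * M.eRk (A ∩ B) + (I ∩ blowUp S (A ∪ B)).encard := by
    calc _ ≤ _ := h2
      _ ≤ _ := add_le_add tA tB
      _ = _ := hc.symm
      _ ≤ _ := by rw [add_comm]; gcongr
  exact (ENat.add_le_add_iff_left (eRk_ne_top' _)).1 h3

theorem ExpIndep.aug [M.Finite] (hS : ∀ e ∈ M.E, (S e).encard = t)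
    (hd : ∀ e ∈ M.E, ∀ f ∈ M.E, e ≠ f → Disjoint (S e) (S f)) {I J : Set β}
    (hI : ExpIndep M t S I) (hJ : ExpIndep M t S J) (hIJ : I.encard < J.encard) :
    ∃ e ∈ J, e ∉ I ∧ ExpIndep M t S (insert e I) := by
  by_contra! hcon
  have hIfin : I.Finite := (blowUp_ground_finite hS).subset hI.1
  -- a maximal tight set
  have hfs : {A | A ⊆ M.E ∧ (t : ℕ∞) * M.eRk A ≤ (I ∩ blowUp S A).encard}.Finite :=
    M.ground_finite.finite_subsets.subset fun A hA ↦ hA.1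
  obtain ⟨T, hT⟩ := hfs.exists_maximal ⟨∅, by simp⟩
  have hsub : J \ I ⊆ blowUp S T := by
    rintro x ⟨hxJ, hxI⟩
    have hni := hcon x hxJ hxI
    have hx0 : insert x I ⊆ blowUp S M.E := insert_subset (hJ.1 hxJ) hI.1
    simp only [ExpIndep, hx0, true_and] at hni
    push Not at hni
    obtain ⟨A, hA, hlt⟩ := hni
    have hxA : x ∈ blowUp S A := by
      by_contra hxA
      rw [insert_inter_of_notMem hxA] at hlt
      exact (hI.2 A hA).not_gt hlt
    rw [insert_inter_of_mem hxA, encard_insert_of_notMem (fun h ↦ hxI h.1)] at hlt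
    have htA : (t : ℕ∞) * M.eRk A ≤ (I ∩ blowUp S A).encard := Order.le_of_lt_add_one hlt
    have hU := hI.tight_union hd hT.prop.1 hA hT.prop.2 htA
    have := hT.le_of_ge (y := T ∪ A) ⟨union_subset hT.prop.1 hA, hU⟩ subset_union_left
    exact blowUp_mono (subset_union_right.trans this) hxA
  have h1 : (J ∩ blowUp S T).encard ≤ (I ∩ blowUp S T).encard :=
    (hJ.2 T hT.prop.1).trans hT.prop.2
  have h2 : (J \ blowUp S T).encard ≤ (I \ blowUp S T).encard := by
    refine encard_le_encard fun x hx ↦ ⟨?_, hx.2⟩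
    by_contra hxI
    exact hx.2 (hsub ⟨hx.1, hxI⟩)
  have h3 := add_le_add h2 h1
  rw [encard_sdiff_add_encard_inter, encard_sdiff_add_encard_inter] at h3
  exact h3.not_gt hIJ

theorem exists_matroid_expIndep [M.Finite] (hS : ∀ e ∈ M.E, (S e).encard = t)
    (hd : ∀ e ∈ M.E, ∀ f ∈ M.E, e ≠ f → Disjoint (S e) (S f)) :
    ∃ N : Matroid β, N.Finite ∧ N.E = blowUp S M.E ∧ ∀ I, N.Indep I ↔ ExpIndep M t S I := by
  have hfin := blowUp_ground_finite hS
  refine ⟨(IndepMatroid.ofFinite hfin (ExpIndep M t S) ?_ ?_ ?_ ?_).matroid, ⟨hfin⟩, rfl,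
    fun I ↦ Iff.rfl⟩
  · exact ⟨empty_subset _, fun A _ ↦ by simp⟩
  · exact fun I J hJ hIJ ↦ ⟨hIJ.trans hJ.1,
      fun A hA ↦ (encard_le_encard (inter_subset_inter_left _ hIJ)).trans (hJ.2 A hA)⟩
  · intro I J hI hJ hIJ
    refine hI.aug hS hd hJ ?_
    rwa [← (hfin.subset hI.1).cast_ncard_eq, ← (hfin.subset hJ.1).cast_ncard_eq, Nat.cast_lt]
  · exact fun I hI ↦ hI.1

theorem eRk_blowUp [M.Finite] (hS : ∀ e ∈ M.E, (S e).encard = t)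
    (hd : ∀ e ∈ M.E, ∀ f ∈ M.E, e ≠ f → Disjoint (S e) (S f)) {N : Matroid β}
    (hN : ∀ I, N.Indep I ↔ ExpIndep M t S I) (hA : A ⊆ M.E) :
    N.eRk (blowUp S A) = t * M.eRk A := by
  apply le_antisymm
  · rw [eRk_le_iff]
    intro I hIA hI
    have := ((hN I).1 hI).2 A hA
    rwa [inter_eq_self_of_subset_left hIA] at this
  · obtain ⟨B, hB⟩ := M.exists_isBasis A hA
    have hBE := hB.indep.subset_ground
    rw [← hB.encard_eq_eRk, ← encard_blowUp hS hd hBE]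
    refine Indep.encard_le_eRk_of_subset ((hN _).2 ⟨blowUp_mono hBE, fun C hC ↦ ?_⟩)
      (blowUp_mono hB.subset)
    rw [← blowUp_inter hd hBE hC, encard_blowUp hS hd (inter_subset_left.trans hBE)]
    gcongr
    exact (hB.indep.subset inter_subset_left).encard_le_eRk_of_subset inter_subset_right

theorem expIndep_swap (hd : ∀ e ∈ M.E, ∀ f ∈ M.E, e ≠ f → Disjoint (S e) (S f))
    {e : α} (he : e ∈ M.E) {x y : β} (hx : x ∈ S e) (hy : y ∈ S e) {Z : Set β} (hxZ : x ∉ Z)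
    (h : ExpIndep M t S (insert x Z)) : ExpIndep M t S (insert y Z) := by
  refine ⟨insert_subset (mem_blowUp.2 ⟨e, he, hy⟩) ((subset_insert _ _).trans h.1),
    fun A hA ↦ ?_⟩
  refine le_trans ?_ (h.2 A hA)
  by_cases heA : e ∈ A
  · rw [insert_inter_of_mem ((mem_blowUp_iff hd hA he hx).2 heA),
      insert_inter_of_mem ((mem_blowUp_iff hd hA he hy).2 heA),
      encard_insert_of_notMem (a := x) (fun h ↦ hxZ h.1)]
    exact encard_insert_le _ _
  · rw [insert_inter_of_notMem (fun h ↦ heA ((mem_blowUp_iff hd hA he hx).1 h)),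
      insert_inter_of_notMem (fun h ↦ heA ((mem_blowUp_iff hd hA he hy).1 h))]

/-- Elements of the same `S e` outside of `Z` lie in the closure of `Z` simultaneously. -/
theorem mem_closure_swap (hd : ∀ e ∈ M.E, ∀ f ∈ M.E, e ≠ f → Disjoint (S e) (S f))
    {N : Matroid β} (hNE : N.E = blowUp S M.E) (hN : ∀ I, N.Indep I ↔ ExpIndep M t S I)
    {e : α} (he : e ∈ M.E) {x y : β} (hx : x ∈ S e) (hy : y ∈ S e) {Z : Set β} (hxZ : x ∉ Z)
    (hyZ : y ∉ Z) (h : x ∈ N.closure Z) : y ∈ N.closure Z := by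
  have hyE : y ∈ N.E := by rw [hNE]; exact mem_blowUp.2 ⟨e, he, hy⟩
  obtain ⟨I, hI⟩ := N.exists_isBasis' Z
  have hxI : x ∉ I := fun h ↦ hxZ (hI.subset h)
  have hyI : y ∉ I := fun h ↦ hyZ (hI.subset h)
  rw [← hI.closure_eq_closure] at h ⊢
  by_contra hcon
  have h1 : N.Indep (insert y I) := (hI.indep.insert_indep_iff_of_notMem hyI).2 ⟨hyE, hcon⟩
  have h2 : N.Indep (insert x I) :=
    (hN _).2 (expIndep_swap hd he hy hx hyI ((hN _).1 h1))
  exact ((hI.indep.insert_indep_iff_of_notMem hxI).1 h2).2 h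

theorem mem_closure_blowUp_iff [M.Finite] (ht : 1 ≤ t) (hS : ∀ e ∈ M.E, (S e).encard = t)
    (hd : ∀ e ∈ M.E, ∀ f ∈ M.E, e ≠ f → Disjoint (S e) (S f)) {N : Matroid β} [N.Finite]
    (hNE : N.E = blowUp S M.E) (hN : ∀ I, N.Indep I ↔ ExpIndep M t S I) (hA : A ⊆ M.E)
    {e : α} (he : e ∈ M.E) {x : β} (hx : x ∈ S e) :
    x ∈ N.closure (blowUp S A) ↔ e ∈ M.closure A := by
  have hAN : blowUp S A ⊆ N.E := by rw [hNE]; exact blowUp_mono hA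
  have hAe : insert e A ⊆ M.E := insert_subset he hA
  have hAeN : blowUp S (insert e A) ⊆ N.E := by rw [hNE]; exact blowUp_mono hAe
  have hr1 := eRk_blowUp hS hd hN hA
  have hr2 := eRk_blowUp hS hd hN hAe
  constructor
  · intro h
    by_cases heA : e ∈ A
    · exact M.mem_closure_of_mem heA hA
    have hn : ∀ y ∈ S e, y ∉ blowUp S A := fun y hy hyA ↦
      heA ((mem_blowUp_iff hd hA he hy).1 hyA)
    have hsub : blowUp S (insert e A) ⊆ N.closure (blowUp S A) := by
      intro y hy
      obtain ⟨f, hf, hyf⟩ := mem_blowUp.1 hy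
      obtain rfl | hf := hf
      · exact mem_closure_swap hd hNE hN he hx hyf (hn _ hx) (hn _ hyf) h
      · exact N.mem_closure_of_mem (mem_blowUp.2 ⟨f, hf, hyf⟩) hAN
    have hle := N.eRk_mono hsub
    rw [eRk_closure_eq, hr1, hr2] at hle
    by_contra hcon
    rw [eRk_insert_eq_add_one ⟨he, hcon⟩, mul_add, mul_one] at hle
    have h0 : (t : ℕ∞) * M.eRk A + t ≤ t * M.eRk A + 0 := by simpa using hle
    rw [ENat.add_le_add_iff_left (eRk_ne_top' _)] at h0
    have : t = 0 := by simpa using h0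
    omega
  · intro h
    have h1 : M.eRk (insert e A) = M.eRk A := by
      rw [← eRk_insert_closure_eq, insert_eq_of_mem h, eRk_closure_eq]
    rw [h1, ← hr1] at hr2
    have hfinX : N.IsRkFinite (blowUp S A) := by
      rw [← eRk_ne_top_iff, hr1]
      exact eRk_ne_top' _
    rw [hfinX.closure_eq_closure_of_subset_of_eRk_ge_eRk (blowUp_mono (subset_insert e A)) hr2.le]
    exact N.mem_closure_of_mem (mem_blowUp.2 ⟨e, mem_insert _ _, hx⟩) hAeN

theorem mem_closure_diff_blowUp_iff [M.Finite] (ht : 1 ≤ t) (hS : ∀ e ∈ M.E, (S e).encard = t)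
    (hd : ∀ e ∈ M.E, ∀ f ∈ M.E, e ≠ f → Disjoint (S e) (S f)) {N : Matroid β} [N.Finite]
    (hNE : N.E = blowUp S M.E) (hN : ∀ I, N.Indep I ↔ ExpIndep M t S I) (hA : A ⊆ M.E)
    {e : α} (he : e ∈ A) {x : β} (hx : x ∈ S e) :
    x ∈ N.closure (blowUp S A \ {x}) ↔ e ∈ M.closure (A \ {e}) := by
  have hA' : A \ {e} ⊆ M.E := sdiff_subset.trans hA
  have hins : insert e (A \ {e}) = A := by simp [insert_eq_of_mem he]
  constructor
  · intro h
    by_contra hcon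
    have hr := eRk_insert_eq_add_one (M := M) ⟨hA he, hcon⟩
    rw [hins] at hr
    have hxA : x ∈ blowUp S A := mem_blowUp.2 ⟨e, he, hx⟩
    have hle : N.eRk (blowUp S A) ≤ N.eRk (blowUp S (A \ {e}) ∪ (S e \ {x})) := by
      rw [← eRk_closure_eq N (_ ∪ _)]
      refine N.eRk_mono fun y hy ↦ ?_
      have hsub : blowUp S A \ {x} ⊆ blowUp S (A \ {e}) ∪ (S e \ {x}) := by
        rintro z ⟨hz, hzx⟩
        obtain ⟨f, hf, hzf⟩ := mem_blowUp.1 hz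
        by_cases hfe : f = e
        · subst hfe; exact Or.inr ⟨hzf, hzx⟩
        · exact Or.inl (mem_blowUp.2 ⟨f, ⟨hf, hfe⟩, hzf⟩)
      by_cases hyx : y = x
      · subst hyx; exact N.closure_subset_closure hsub h
      · refine N.mem_closure_of_mem' (hsub ⟨hy, hyx⟩) ?_
        rw [hNE]; exact blowUp_mono hA hy
    have h2 := hle.trans (N.eRk_union_le_eRk_add_encard _ _)
    rw [eRk_blowUp hS hd hN hA, eRk_blowUp hS hd hN hA', hr, mul_add, mul_one,
      ENat.add_le_add_iff_left (eRk_ne_top' _), ← hS e (hA he),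
      ← encard_sdiff_singleton_add_one hx] at h2
    have hne : (S e \ {x}).encard ≠ ⊤ :=
      encard_ne_top_iff.2 ((finite_of_encard_eq_coe (hS e (hA he))).subset sdiff_subset)
    exact (ENat.lt_add_one_iff hne).2 le_rfl |>.not_ge h2
  · intro h
    refine N.closure_subset_closure ?_
      ((mem_closure_blowUp_iff ht hS hd hNE hN hA' (hA he) hx).2 h)
    refine subset_sdiff_singleton (blowUp_mono sdiff_subset) fun hx' ↦ ?_
    exact ((mem_blowUp_iff hd hA' (hA he) hx).1 hx').2 rfl

theorem isCyclicFlat_iff {X : Set α} :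
    M.IsCyclicFlat X ↔ M.closure X = X ∧ ∀ x ∈ X, x ∈ M.closure (X \ {x}) := by
  rw [IsCyclicFlat, isFlat_iff_closure_eq]
  refine and_congr_right fun hX ↦ ⟨?_, fun h ↦ ?_⟩
  · rintro ⟨C, hC, rfl⟩ x ⟨K, hK, hxK⟩
    exact M.closure_subset_closure (sdiff_subset_sdiff_left (subset_sUnion_of_mem hK))
      ((hC K hK).subset_closure_sdiff_singleton x hxK)
  · refine ⟨{K | M.IsCircuit K ∧ K ⊆ X}, fun K hK ↦ hK.1, subset_antisymm (fun x hx ↦ ?_)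
      (sUnion_subset fun K hK ↦ hK.2)⟩
    obtain ⟨K, hKX, hK, hxK⟩ := exists_isCircuit_of_mem_closure (h x hx) (by simp)
    refine ⟨K, ⟨hK, hKX.trans ?_⟩, hxK⟩
    rw [insert_sdiff_singleton, insert_eq_of_mem hx]

/-- Existence of `t`-expansions. -/
theorem exists_isTExpansion [M.Finite] (ht : 1 ≤ t) (hS : ∀ e ∈ M.E, (S e).encard = t)
    (hd : ∀ e ∈ M.E, ∀ f ∈ M.E, e ≠ f → Disjoint (S e) (S f)) :
    ∃ N : Matroid β, M.IsTExpansion t S N := by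
  obtain ⟨N, hNf, hNE, hN⟩ := exists_matroid_expIndep hS hd
  have hcl : ∀ A ⊆ M.E, N.closure (blowUp S A) = blowUp S (M.closure A) := by
    intro A hA
    ext x
    refine ⟨fun h ↦ ?_, fun h ↦ ?_⟩
    · have hxE := N.closure_subset_ground _ h
      rw [hNE] at hxE
      obtain ⟨e, he, hx⟩ := mem_blowUp.1 hxE
      exact mem_blowUp.2 ⟨e, (mem_closure_blowUp_iff ht hS hd hNE hN hA he hx).1 h, hx⟩
    · obtain ⟨e, he, hx⟩ := mem_blowUp.1 h
      exact (mem_closure_blowUp_iff ht hS hd hNE hN hA (M.closure_subset_ground _ he) hx).2 he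
  have hne : ∀ e ∈ M.E, (S e).Nonempty := by
    intro e he
    rw [← encard_pos, hS e he]
    exact_mod_cast ht
  have hsub : ∀ A ⊆ M.E, ∀ B ⊆ M.E, blowUp S A ⊆ blowUp S B → A ⊆ B := by
    intro A hA B hB h e he
    obtain ⟨x, hx⟩ := hne e (hA he)
    exact (mem_blowUp_iff hd hB (hA he) hx).1 (h (mem_blowUp.2 ⟨e, he, hx⟩))
  have hiff : ∀ A ⊆ M.E, (N.IsCyclicFlat (blowUp S A) ↔ M.IsCyclicFlat A) := by
    intro A hA
    rw [isCyclicFlat_iff, isCyclicFlat_iff, hcl A hA]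
    refine and_congr ⟨fun h ↦ ?_, fun h ↦ by rw [h]⟩ ⟨fun h e he ↦ ?_, fun h x hx ↦ ?_⟩
    · exact subset_antisymm (hsub _ (M.closure_subset_ground A) A hA h.subset)
        (M.subset_closure A hA)
    · obtain ⟨x, hx⟩ := hne e (hA he)
      exact (mem_closure_diff_blowUp_iff ht hS hd hNE hN hA he hx).1
        (h x (mem_blowUp.2 ⟨e, he, hx⟩))
    · obtain ⟨e, he, hxe⟩ := mem_blowUp.1 hx
      exact (mem_closure_diff_blowUp_iff ht hS hd hNE hN hA he hxe).2 (h e he)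
  refine ⟨N, hS, hd, hNE, fun X ↦ ⟨fun hX ↦ ?_, ?_⟩, fun A hA ↦
    eRk_blowUp hS hd hN hA.1.subset_ground⟩
  · have hXA : X = blowUp S {e ∈ M.E | (S e ∩ X).Nonempty} := by
      rw [isCyclicFlat_iff] at hX
      ext y
      rw [mem_blowUp]
      constructor
      · intro hy
        have hyE : y ∈ N.E := by rw [← hX.1] at hy; exact N.closure_subset_ground _ hy
        rw [hNE] at hyE
        obtain ⟨e, he, hye⟩ := mem_blowUp.1 hyE
        exact ⟨e, ⟨he, y, hye, hy⟩, hye⟩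
      · rintro ⟨e, ⟨he, x, hxe, hxX⟩, hye⟩
        by_contra hyX
        have := mem_closure_swap hd hNE hN he hxe hye (Z := X \ {x}) (by simp)
          (fun h ↦ hyX h.1) (hX.2 x hxX)
        rw [← hX.1] at hyX
        exact hyX (N.closure_subset_closure sdiff_subset this)
    refine ⟨_, ?_, hXA⟩
    rw [← hiff _ (sep_subset _ _), ← hXA]
    exact hX
  · rintro ⟨A, hA, rfl⟩
    exact (hiff A hA.1.subset_ground).2 hA

end Existence

end Matroid

/-!
The proof compares the sets of a presentation with the cyclic flats. If `A` is a presentation of a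
finite matroid, a cyclic flat `F` meets exactly `r(F)` of the sets `A i`
(`Presents.encard_hitting_eq`). Conversely, a set `I` is independent as soon as `|I ∩ F| ≤ r(F)` for
all cyclic flats `F` (`indep_of_forall_isCyclicFlat`). It follows that the independent sets of the
`t`-expansion `N` of `M` are those given by the inequalities `|I ∩ S_A| ≤ t * r(A)` for *all* sets
`A` (`IsTExpansion.indep_iff`), and that `r_N(S_A) = t * r_M(A)` for all `A`.

From `M` to `N`: by Hall's theorem, `t` copies of each `S_{A i}` present `N`
(`IsTExpansion.presents`).

From `N` to `M`: pad a presentation `A` of `N` with empty sets, until the number `m` of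
sets is a multiple of `t`. For each `i` there is a largest cyclic flat `F i` of `M` such that
`S_{F i}` is disjoint from `A i` (`Presents.exists_largest_isCyclicFlat`). The number of `i` with
`G ⊆ F i` is `m - t * r(G)` for each cyclic flat `G`, a multiple of `t`. By induction from the
largest flats downwards, each cyclic flat occurs a multiple of `t` times among the `F i`
(`exists_finset_of_dvd`), and the complements of the `F i`, taken with multiplicities
divided by `t`, present `M`.

A matroid is fundamental transversal if and only if it has a base `B` with `|B ∩ F| = r(F)`
for all cyclic flats `F` (`isFundamentalTransversal_iff`): private elements of a
presentation form such a base, and for such a base its fundamental cocircuits are a presentation. If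
`B` is such a base of `M`, then `S_B` is one of `N`. Conversely, let `b i` be private elements of a
presentation of `N`, with `b i ∈ S_{e i}`. Then `e i` lies in a cyclic flat `G` of `M` if and
only if `G` is not contained in `F i`. As at most `t` of the `b i` lie in one `S_e`, there
are enough elements `e i` over each value of `F` to choose a base of `M` with the multiplicities of
`F` divided by `t`.
-/

namespace Matroid

/-! ### Partial transversals and Hall's theorem -/

section Matching

variable {α ι : Type*} {A : ι → Set α} {I X Y : Set α}

/-- The indices of the sets in the family `A` that meet `X`. -/
def hitting (A : ι → Set α) (X : Set α) : Set ι := {i | (A i ∩ X).Nonempty}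

/-- `I` is a partial transversal of the family `A`, which may have any index type; for the index
type `Fin k` this is `IsPartialTransversal`. -/
def HasMatching (A : ι → Set α) (I : Set α) : Prop :=
  ∃ φ : I → ι, Function.Injective φ ∧ ∀ e : I, (e : α) ∈ A (φ e)

theorem mem_hitting {i : ι} : i ∈ hitting A X ↔ ∃ x ∈ X, x ∈ A i :=
  ⟨fun ⟨x, hA, hX⟩ ↦ ⟨x, hX, hA⟩, fun ⟨x, hX, hA⟩ ↦ ⟨x, hA, hX⟩⟩

theorem hitting_mono (h : X ⊆ Y) : hitting A X ⊆ hitting A Y :=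
  fun _ hi ↦ hi.mono (inter_subset_inter_right _ h)

theorem HasMatching.encard_le (h : HasMatching A I) : I.encard ≤ (hitting A I).encard := by
  obtain ⟨φ, hφ, hA⟩ := h
  exact Function.Embedding.encard_le
    ⟨fun e ↦ ⟨φ e, mem_hitting.2 ⟨e, e.2, hA e⟩⟩, fun a b hab ↦ hφ (congrArg Subtype.val hab)⟩

theorem HasMatching.subset (h : HasMatching A I) (hX : X ⊆ I) : HasMatching A X := by
  obtain ⟨φ, hφ, hA⟩ := h
  exact ⟨fun e ↦ φ ⟨e, hX e.2⟩, fun a b hab ↦ by simpa [Subtype.ext_iff] using hφ hab,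
    fun e ↦ hA _⟩

/-- Hall's theorem for partial transversals. -/
theorem hasMatching_of_forall_encard_le [Finite ι]
    (h : ∀ Y ⊆ I, Y.encard ≤ (hitting A Y).encard) : HasMatching A I := by
  classical
  have := Fintype.ofFinite ι
  refine (Fintype.all_card_le_filter_rel_iff_exists_injective
    (fun (e : I) (i : ι) ↦ (e : α) ∈ A i)).1 fun T ↦ ?_
  have h1 := h ((↑) '' (T : Set I)) (by simp)
  rw [Subtype.val_injective.encard_image, encard_coe_eq_coe_finsetCard] at h1
  have h2 : hitting A ((↑) '' (T : Set I)) =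
      (({b | ∃ a ∈ T, (a : α) ∈ A b} : Finset ι) : Set ι) := by
    ext i
    simp [mem_hitting]
  rw [h2, encard_coe_eq_coe_finsetCard] at h1
  exact_mod_cast h1

theorem HasMatching.reindex {κ : Type*} {B : κ → Set α} (f : ι → κ)
    (hf : ∀ i j x y, x ∈ A i → y ∈ A j → f i = f j → i = j) (hAB : ∀ i, A i ⊆ B (f i))
    (h : HasMatching A I) : HasMatching B I := by
  obtain ⟨φ, hφ, hA⟩ := h
  exact ⟨fun e ↦ f (φ e), fun a b hab ↦ hφ (hf _ _ _ _ (hA a) (hA b) hab), fun e ↦ hAB _ (hA e)⟩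

end Matching

/-! ### Cyclic flats -/

section CyclicFlat

variable {α : Type*} {M : Matroid α} {I F X : Set α}

theorem isCyclicFlat_closure (hX : ∀ x ∈ X, x ∈ M.closure (X \ {x})) :
    M.IsCyclicFlat (M.closure X) := by
  have hXE : X ⊆ M.E := fun x hx ↦ M.closure_subset_ground _ (hX x hx)
  refine isCyclicFlat_iff.2 ⟨M.closure_closure X, fun x hx ↦ ?_⟩
  by_cases hxX : x ∈ X
  · exact M.closure_subset_closure (sdiff_subset_sdiff_left (M.subset_closure X hXE)) (hX x hxX)
  · exact M.closure_subset_closure (subset_sdiff_singleton (M.subset_closure X hXE) hxX) hx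

theorem mem_closure_sdiff_of_sUnion {𝒢 : Set (Set α)} (h : ∀ G ∈ 𝒢, M.IsCyclicFlat G) :
    ∀ x ∈ ⋃₀ 𝒢, x ∈ M.closure (⋃₀ 𝒢 \ {x}) := by
  rintro x ⟨G, hG, hx⟩
  exact M.closure_subset_closure (sdiff_subset_sdiff_left (subset_sUnion_of_mem hG))
    ((isCyclicFlat_iff.1 (h G hG)).2 x hx)

/-- The cyclic flats and their ranks determine a finite matroid. -/
theorem indep_of_forall_isCyclicFlat [M.Finite] (hI : I ⊆ M.E)
    (h : ∀ F, M.IsCyclicFlat F → (I ∩ F).encard ≤ M.eRk F) : M.Indep I := by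
  by_contra hcon
  obtain ⟨C, hCI, hC⟩ := ((not_indep_iff hI).1 hcon).exists_isCircuit_subset
  have h1 := h _ (isCyclicFlat_closure fun x hx ↦ hC.subset_closure_sdiff_singleton x hx)
  rw [eRk_closure_eq] at h1
  have h2 : C.encard ≤ M.eRk C :=
    (encard_le_encard (subset_inter hCI (M.subset_closure C))).trans h1
  exact (hC.dep.eRk_lt_encard).not_ge h2

end CyclicFlat

/-! ### Presentations of transversal matroids -/

section Presentation

variable {α ι : Type*} {M : Matroid α} {A : ι → Set α} {C F I X : Set α}

/-- `IsPresentation` for a family with an arbitrary index type. -/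
def Presents (M : Matroid α) (A : ι → Set α) : Prop :=
  (∀ i, A i ⊆ M.E) ∧ ∀ I : Set α, M.Indep I ↔ HasMatching A I

theorem Presents.exists_fin [Finite ι] (h : M.Presents A) :
    ∃ (k : ℕ) (e : Fin k ≃ ι), M.IsPresentation (A ∘ e) := by
  obtain ⟨k, ⟨e⟩⟩ := Finite.exists_equiv_fin ι
  refine ⟨k, e.symm, fun i ↦ h.1 _, fun I ↦ (h.2 I).trans ⟨fun hI ↦ ?_, fun hI ↦ ?_⟩⟩
  · exact hI.reindex (B := A ∘ e.symm) e (fun i j _ _ _ _ hij ↦ e.injective hij) fun i ↦ by simp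
  · exact HasMatching.reindex (A := A ∘ e.symm) e.symm
      (fun i j _ _ _ _ hij ↦ e.symm.injective hij) (fun i ↦ subset_rfl) hI

theorem Presents.isTransversal [Finite ι] (h : M.Presents A) : M.IsTransversal := by
  obtain ⟨k, e, he⟩ := h.exists_fin
  exact ⟨k, _, he⟩

theorem Presents.isFundamentalTransversal [Finite ι] (h : M.Presents A)
    (hb : ∀ i, ∃ b ∈ A i, ∀ j, j ≠ i → b ∉ A j) : M.IsFundamentalTransversal := by
  obtain ⟨k, e, he⟩ := h.exists_fin
  refine ⟨k, _, he, fun i ↦ ?_⟩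
  obtain ⟨b, hbi, hbj⟩ := hb (e i)
  exact ⟨b, hbi, fun j hj ↦ hbj _ fun h ↦ hj (e.injective h)⟩

theorem Presents.eRk_le_encard_hitting (h : M.Presents A) (X : Set α) :
    M.eRk X ≤ (hitting A X).encard := by
  rw [eRk_le_iff]
  exact fun I hIX hI ↦ ((h.2 I).1 hI).encard_le.trans (encard_le_encard (hitting_mono hIX))

theorem Presents.encard_hitting_lt_of_isCircuit [Finite ι] (h : M.Presents A)
    (hC : M.IsCircuit C) : (hitting A C).encard < C.encard := by
  by_contra! hcon
  refine hC.not_indep ((h.2 C).2 (hasMatching_of_forall_encard_le fun Y hY ↦ ?_))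
  obtain rfl | hlt := hY.eq_or_ssubset
  · exact hcon
  · exact ((h.2 Y).1 (hC.ssubset_indep hlt)).encard_le

/-- A union of circuits meets no more sets of a presentation than its rank: if `B` is a basis of
`X`, then all these sets are matched to elements of `B`. -/
theorem Presents.encard_hitting_le [M.Finite] [Finite ι] (h : M.Presents A)
    (hX : ∀ x ∈ X, x ∈ M.closure (X \ {x})) : (hitting A X).encard ≤ M.eRk X := by
  have hXE : X ⊆ M.E := fun x hx ↦ M.closure_subset_ground _ (hX x hx)
  obtain ⟨B, hB⟩ := M.exists_isBasis X
  obtain ⟨φ, hφ, hA⟩ := (h.2 B).1 hB.indep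
  suffices hsub : hitting A X ⊆ range φ by
    rw [← hB.encard_eq_eRk]
    exact (encard_le_encard hsub).trans (by
      rw [← image_univ]
      exact (encard_image_le _ _).trans (by rw [encard_univ]; rfl))
  intro i hi
  by_contra hiφ
  obtain ⟨x, hxX, hxi⟩ := mem_hitting.1 hi
  -- a circuit `C` in `insert y B` that contains `x`
  obtain ⟨y, C, hCB, hC, hyC, hxC⟩ :
      ∃ y C, C ⊆ insert y B ∧ M.IsCircuit C ∧ y ∈ C ∧ x ∈ C := by
    have hcl : ∀ y ∈ X, y ∉ B → ∃ C ⊆ insert y B, M.IsCircuit C ∧ y ∈ C := fun y hy hyB ↦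
      exists_isCircuit_of_mem_closure (hB.subset_closure hy) hyB
    by_cases hxB : x ∈ B
    · by_contra! hcon
      refine hB.indep.notMem_closure_sdiff_of_mem hxB
        (M.closure_subset_closure_of_subset_closure (fun y hy ↦ ?_) (hX x hxX))
      by_cases hyB : y ∈ B
      · exact M.mem_closure_of_mem' ⟨hyB, hy.2⟩ (hXE hy.1)
      obtain ⟨C, hCB, hC, hyC⟩ := hcl y hy.1 hyB
      refine M.closure_subset_closure (fun z hz ↦ ?_) (hC.subset_closure_sdiff_singleton y hyC)
      refine ⟨(hCB hz.1).resolve_left hz.2, ?_⟩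
      rintro rfl
      exact hcon y C hCB hC hyC hz.1
    · obtain ⟨C, hCB, hC, hxC⟩ := hcl x hxX hxB
      exact ⟨x, C, hCB, hC, hxC, hxC⟩
  have hCB' : C \ {y} ⊆ B := fun z hz ↦ (hCB hz.1).resolve_left hz.2
  -- `C` meets `i` and all sets matched to the elements of `C \ {y}`
  have hsub : insert i (range fun z : ↥(C \ {y}) ↦ φ ⟨z, hCB' z.2⟩) ⊆ hitting A C := by
    rw [insert_subset_iff]
    refine ⟨mem_hitting.2 ⟨x, hxC, hxi⟩, ?_⟩
    rintro _ ⟨z, rfl⟩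
    exact mem_hitting.2 ⟨z, z.2.1, hA ⟨z, hCB' z.2⟩⟩
  have hinj : Function.Injective fun z : ↥(C \ {y}) ↦ φ ⟨z, hCB' z.2⟩ := fun a b hab ↦ by
    simpa [Subtype.ext_iff] using hφ hab
  have hle := encard_le_encard hsub
  rw [encard_insert_of_notMem (by rintro ⟨z, rfl⟩; exact hiφ ⟨_, rfl⟩)] at hle
  refine (h.encard_hitting_lt_of_isCircuit hC).not_ge (le_trans ?_ hle)
  rw [← encard_sdiff_singleton_add_one hyC]
  gcongr
  exact hinj.encard_range

theorem Presents.encard_hitting_eq [M.Finite] [Finite ι] (h : M.Presents A)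
    (hF : M.IsCyclicFlat F) : (hitting A F).encard = M.eRk F :=
  (h.encard_hitting_le (isCyclicFlat_iff.1 hF).2).antisymm (h.eRk_le_encard_hitting F)

theorem Presents.hitting_closure [M.Finite] [Finite ι] (h : M.Presents A)
    (hX : ∀ x ∈ X, x ∈ M.closure (X \ {x})) : hitting A (M.closure X) = hitting A X := by
  have hXE : X ⊆ M.E := fun x hx ↦ M.closure_subset_ground _ (hX x hx)
  refine ((Set.toFinite _).eq_of_subset_of_encard_le (hitting_mono (M.subset_closure X)) ?_).symm
  rw [h.encard_hitting_eq (isCyclicFlat_closure hX), eRk_closure_eq]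
  exact h.eRk_le_encard_hitting X

/-- Among the cyclic flats disjoint from a set of a presentation there is a largest one. -/
theorem Presents.exists_largest_isCyclicFlat [M.Finite] [Finite ι] (h : M.Presents A) (i : ι) :
    ∃ K, M.IsCyclicFlat K ∧ ∀ G, M.IsCyclicFlat G → (i ∉ hitting A G ↔ G ⊆ K) := by
  let 𝒢 := {G | M.IsCyclicFlat G ∧ i ∉ hitting A G}
  have hcyc := mem_closure_sdiff_of_sUnion (M := M) (𝒢 := 𝒢) fun G hG ↦ hG.1
  have hE : ⋃₀ 𝒢 ⊆ M.E := fun x hx ↦ M.closure_subset_ground _ (hcyc x hx)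
  refine ⟨M.closure (⋃₀ 𝒢), isCyclicFlat_closure hcyc, fun G hG ↦ ⟨fun hi ↦ ?_, fun hsub hi ↦ ?_⟩⟩
  · have hG' : G ∈ 𝒢 := ⟨hG, hi⟩
    exact (subset_sUnion_of_mem hG').trans (M.subset_closure _)
  · have := hitting_mono hsub hi
    rw [h.hitting_closure hcyc] at this
    obtain ⟨x, ⟨G', hG', hx⟩, hxi⟩ := mem_hitting.1 this
    exact hG'.2 (mem_hitting.2 ⟨x, hx, hxi⟩)

/-- For a family indexed by `ι`, adding empty sets makes the index type `ι × Fin t`. -/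
theorem Presents.pad (h : M.Presents A) {t : ℕ} (ht : 1 ≤ t) :
    M.Presents fun i : ι × Fin t ↦ {x ∈ A i.1 | (i.2 : ℕ) = 0} := by
  refine ⟨fun i ↦ (sep_subset _ _).trans (h.1 _), fun I ↦ (h.2 I).trans ⟨fun hI ↦ ?_, fun hI ↦ ?_⟩⟩
  · exact hI.reindex (fun i ↦ (i, ⟨0, ht⟩)) (fun i j _ _ _ _ hij ↦ congrArg Prod.fst hij)
      fun i x hx ↦ ⟨hx, rfl⟩
  · exact hI.reindex Prod.fst (fun i j x y hx hy hij ↦ Prod.ext hij (Fin.ext (hx.2.trans hy.2.symm)))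
      fun i x hx ↦ hx.1

end Presentation

/-! ### Rank and independence in a `t`-expansion -/

section Expansion

universe u v

variable {α : Type u} {β : Type v} {M : Matroid α} {N : Matroid β} {t : ℕ} {S : α → Set β}
  {A F I : Set α} {J Y : Set β}

theorem IsTExpansion.finite [M.Finite] (h : M.IsTExpansion t S N) : N.Finite :=
  ⟨by rw [h.ground_eq]; exact blowUp_ground_finite h.encard_eq⟩

theorem IsTExpansion.isCyclicFlat_blowUp (h : M.IsTExpansion t S N) (hF : M.IsCyclicFlat F) :
    N.IsCyclicFlat (blowUp S F) :=
  (h.isCyclicFlat_iff _).2 ⟨F, hF, rfl⟩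

theorem IsTExpansion.nonempty (h : M.IsTExpansion t S N) (ht : 1 ≤ t) {e : α} (he : e ∈ M.E) :
    (S e).Nonempty := by
  rw [← encard_pos, h.encard_eq e he]
  exact_mod_cast ht

theorem IsTExpansion.blowUp_subset_blowUp_iff (h : M.IsTExpansion t S N) (ht : 1 ≤ t)
    {B : Set α} (hA : A ⊆ M.E) (hB : B ⊆ M.E) : blowUp S A ⊆ blowUp S B ↔ A ⊆ B := by
  refine ⟨fun hAB e he ↦ ?_, blowUp_mono⟩
  obtain ⟨x, hx⟩ := h.nonempty ht (hA he)
  exact (mem_blowUp_iff h.disjoint hB (hA he) hx).1 (hAB (mem_blowUp.2 ⟨e, he, hx⟩))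

/-- Coloops of `M ↾ A` can be removed from `A` one by one, and a set `A` for which `M ↾ A` has no
coloops has the same rank as the cyclic flat that it spans. -/
theorem IsTExpansion.eRk_blowUp_le [M.Finite] (h : M.IsTExpansion t S N) (hA : A ⊆ M.E) :
    N.eRk (blowUp S A) ≤ t * M.eRk A := by
  induction hn : A.encard using WellFoundedLT.induction generalizing A with
  | ind n ih =>
    subst hn
    by_cases hcyc : ∀ x ∈ A, x ∈ M.closure (A \ {x})
    · have h1 := N.eRk_mono (blowUp_mono (S := S) (M.subset_closure A hA))
      rwa [h.eRk_eq _ (isCyclicFlat_closure hcyc), eRk_closure_eq] at h1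
    · push Not at hcyc
      obtain ⟨e, he, hecl⟩ := hcyc
      have hr := eRk_insert_eq_add_one (M := M) ⟨hA he, hecl⟩
      rw [insert_sdiff_singleton, insert_eq_of_mem he] at hr
      have hlt : (A \ {e}).encard < A.encard :=
        ((M.ground_finite.subset hA).subset sdiff_subset).encard_lt_encard
          (sdiff_singleton_ssubset.2 he)
      have h1 := ih _ hlt (sdiff_subset.trans hA) rfl
      have h2 : blowUp S A = blowUp S (A \ {e}) ∪ S e := by
        conv_lhs => rw [← insert_eq_of_mem he, ← insert_sdiff_singleton]
        rw [blowUp, biUnion_insert, union_comm]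
        rfl
      rw [h2, hr, mul_add, mul_one]
      refine (N.eRk_union_le_eRk_add_encard _ _).trans ?_
      rw [h.encard_eq e (hA he)]
      gcongr

/-- The independent sets of a `t`-expansion are described by inequalities for all sets `A`, and not
only for cyclic flats. -/
theorem IsTExpansion.indep_iff [M.Finite] (h : M.IsTExpansion t S N) (J : Set β) :
    N.Indep J ↔ ExpIndep M t S J := by
  have := h.finite
  refine ⟨fun hJ ↦ ⟨h.ground_eq ▸ hJ.subset_ground, fun A hA ↦ ?_⟩, fun hJ ↦ ?_⟩
  · exact ((hJ.subset inter_subset_left).encard_le_eRk_of_subset inter_subset_right).trans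
      (h.eRk_blowUp_le hA)
  · refine indep_of_forall_isCyclicFlat (h.ground_eq ▸ hJ.1) fun F hF ↦ ?_
    obtain ⟨A, hA, rfl⟩ := (h.isCyclicFlat_iff F).1 hF
    rw [h.eRk_eq A hA]
    exact hJ.2 A hA.1.subset_ground

theorem IsTExpansion.eRk_blowUp [M.Finite] (h : M.IsTExpansion t S N) (hA : A ⊆ M.E) :
    N.eRk (blowUp S A) = t * M.eRk A :=
  Matroid.eRk_blowUp h.encard_eq h.disjoint h.indep_iff hA

theorem IsTExpansion.eRank_eq [M.Finite] (h : M.IsTExpansion t S N) :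
    N.eRank = t * M.eRank := by
  rw [← eRk_ground, ← eRk_ground, h.ground_eq, h.eRk_blowUp subset_rfl]

theorem IsTExpansion.indep_blowUp [M.Finite] (h : M.IsTExpansion t S N) (hI : M.Indep I) :
    N.Indep (blowUp S I) := by
  have := h.finite
  rw [indep_iff_eRk_eq_encard, h.eRk_blowUp hI.subset_ground, hI.eRk_eq_encard,
    encard_blowUp h.encard_eq h.disjoint hI.subset_ground]

/-- The elements of `M` represented in a set of elements of its `t`-expansion. -/
def support (M : Matroid α) (S : α → Set β) (Y : Set β) : Set α := {e ∈ M.E | (S e ∩ Y).Nonempty}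

theorem support_subset : support M S Y ⊆ M.E := sep_subset _ _

theorem subset_blowUp_support (hY : Y ⊆ blowUp S M.E) : Y ⊆ blowUp S (support M S Y) := by
  intro y hy
  obtain ⟨e, he, hye⟩ := mem_blowUp.1 (hY hy)
  exact mem_blowUp.2 ⟨e, ⟨he, y, hye, hy⟩, hye⟩

/-- Taking `t` copies of each set `blowUp S (A i)` turns a presentation of `M` into one of its
`t`-expansion. -/
theorem IsTExpansion.presents {ι : Type*} [Finite ι] [M.Finite] (h : M.IsTExpansion t S N)
    {A : ι → Set α} (hA : M.Presents A) :
    N.Presents fun i : ι × Fin t ↦ blowUp S (A i.1) := by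
  have := h.finite
  have hcard : ∀ X : Set β, (hitting (fun i : ι × Fin t ↦ blowUp S (A i.1)) X).encard =
      t * (hitting (fun i ↦ blowUp S (A i)) X).encard := by
    intro X
    have : hitting (fun i : ι × Fin t ↦ blowUp S (A i.1)) X =
        hitting (fun i ↦ blowUp S (A i)) X ×ˢ univ := by
      ext i
      simp [hitting]
    rw [this, encard_prod, mul_comm]
    simp
  refine ⟨fun i ↦ h.ground_eq ▸ blowUp_mono (hA.1 _), fun J ↦ ⟨fun hJ ↦ ?_, fun hJ ↦ ?_⟩⟩
  · refine hasMatching_of_forall_encard_le fun Y hY ↦ ?_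
    have hJ' := (h.indep_iff J).1 hJ
    have hYE := hY.trans hJ'.1
    have h1 : Y.encard ≤ t * M.eRk (support M S Y) :=
      (encard_le_encard (subset_inter hY (subset_blowUp_support hYE))).trans
        (hJ'.2 _ support_subset)
    rw [hcard]
    refine h1.trans ?_
    gcongr
    refine (hA.eRk_le_encard_hitting _).trans (encard_le_encard fun i hi ↦ ?_)
    obtain ⟨e, ⟨-, y, hye, hy⟩, hei⟩ := mem_hitting.1 hi
    exact mem_hitting.2 ⟨y, hy, mem_blowUp.2 ⟨e, hei, hye⟩⟩
  · have hJE : J ⊆ N.E := by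
      obtain ⟨φ, -, hφ⟩ := hJ
      intro x hx
      rw [h.ground_eq]
      exact blowUp_mono (hA.1 _) (hφ ⟨x, hx⟩)
    refine indep_of_forall_isCyclicFlat hJE fun G hG ↦ ?_
    obtain ⟨F, hF, rfl⟩ := (h.isCyclicFlat_iff G).1 hG
    refine (hJ.subset inter_subset_left).encard_le.trans ?_
    rw [hcard, h.eRk_eq F hF, ← hA.encard_hitting_eq hF]
    gcongr
    intro i hi
    obtain ⟨y, ⟨-, hyF⟩, hyi⟩ := mem_hitting.1 hi
    obtain ⟨e, he, hye⟩ := mem_blowUp.1 hyi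
    exact mem_hitting.2 ⟨e, (mem_blowUp_iff h.disjoint hF.1.subset_ground (hA.1 _ he) hye).1 hyF,
      he⟩

end Expansion

/-! ### Fundamental transversal matroids -/

section Fundamental

universe u

variable {α : Type u} {ι : Type*} {M : Matroid α} {A : ι → Set α} {B F : Set α} {b : ι → α}

/-- If each set of a presentation has a private element, then a cyclic flat meets a set of the
presentation if and only if it contains its private element. -/
theorem Presents.mem_hitting_iff_of_private [M.Finite] [Finite ι] (h : M.Presents A)
    (hb : ∀ i, b i ∈ A i) (hb' : ∀ i j, j ≠ i → b i ∉ A j) (hF : M.IsCyclicFlat F) (i : ι) :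
    i ∈ hitting A F ↔ b i ∈ F := by
  refine ⟨fun hi ↦ ?_, fun hi ↦ mem_hitting.2 ⟨_, hi, hb i⟩⟩
  have hE : insert (b i) F ⊆ M.E := insert_subset (h.1 _ (hb i)) hF.1.subset_ground
  have h1 : hitting A (insert (b i) F) ⊆ hitting A F := by
    intro j hj
    obtain ⟨x, rfl | hx, hxj⟩ := mem_hitting.1 hj
    · obtain rfl : j = i := by
        by_contra hne
        exact hb' i j hne hxj
      exact hi
    · exact mem_hitting.2 ⟨x, hx, hxj⟩
  have h2 := (h.eRk_le_encard_hitting (insert (b i) F)).trans (encard_le_encard h1)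
  rw [h.encard_hitting_eq hF] at h2
  have h3 := (M.isRkFinite_set F).closure_eq_closure_of_subset_of_eRk_ge_eRk
    (subset_insert (b i) F) h2
  rw [hF.1.closure] at h3
  rw [h3]
  exact M.mem_closure_of_mem (mem_insert _ _) hE

theorem Presents.isBase_range [M.Finite] [Finite ι] (h : M.Presents A)
    (hb : ∀ i, b i ∈ A i) (hinj : Function.Injective b) :
    M.IsBase (range b) := by
  have hind : M.Indep (range b) := by
    refine (h.2 _).2 ⟨fun e ↦ e.2.choose, fun e f hef ↦ ?_, fun e ↦ ?_⟩
    · rw [Subtype.ext_iff, ← e.2.choose_spec, ← f.2.choose_spec]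
      exact congrArg b hef
    · nth_rw 1 [← e.2.choose_spec]
      exact hb _
  refine hind.isBase_of_eRk_ge (Set.toFinite _) ?_
  rw [hind.eRk_eq_encard, ← eRk_ground]
  refine (h.eRk_le_encard_hitting _).trans ((encard_le_encard (subset_univ _)).trans ?_)
  rw [encard_univ]
  exact hinj.encard_range

theorem injective_of_private (hb : ∀ i, b i ∈ A i) (hb' : ∀ i j, j ≠ i → b i ∉ A j) :
    Function.Injective b := by
  intro i j hij
  by_contra hne
  exact hb' j i hne (hij ▸ hb i)

theorem encard_range_inter (hinj : Function.Injective b) (F : Set α) :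
    (range b ∩ F).encard = {i | b i ∈ F}.encard := by
  rw [← hinj.encard_image {i | b i ∈ F}]
  congr 1
  ext x
  constructor
  · rintro ⟨⟨i, rfl⟩, hi⟩
    exact ⟨i, hi, rfl⟩
  · rintro ⟨i, hi, rfl⟩
    exact ⟨⟨i, rfl⟩, hi⟩

/-- A presentation with private elements: for a base `B` that contains a basis of each
cyclic flat, the fundamental cocircuits of `B` present `M`. -/
theorem IsBase.presents_of_encard_inter [M.Finite] (hB : M.IsBase B)
    (h : ∀ F, M.IsCyclicFlat F → (B ∩ F).encard = M.eRk F) :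
    M.Presents fun e : B ↦ M.E \ M.closure (B \ {(e : α)}) := by
  have : Finite B := M.ground_finite.subset hB.subset_ground
  refine ⟨fun e ↦ sdiff_subset, fun I ↦ ⟨fun hI ↦ ?_, fun hI ↦ ?_⟩⟩
  · refine hasMatching_of_forall_encard_le fun Y hY ↦ ?_
    set T := hitting (fun e : B ↦ M.E \ M.closure (B \ {(e : α)})) Y with hT
    -- it suffices that the elements of `B` whose cocircuits meet `Y` span `Y`
    suffices hcl : Y ⊆ M.closure ((↑) '' T) by
      refine ((hI.subset hY).encard_le_eRk_of_subset hcl).trans ?_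
      rw [eRk_closure_eq]
      exact (M.eRk_le_encard _).trans (encard_image_le _ _)
    have hTE : (↑) '' T ⊆ M.E := by
      rintro _ ⟨e, -, rfl⟩
      exact hB.subset_ground e.2
    intro y hy
    have hyE := hI.subset_ground (hY hy)
    by_cases hyB : y ∈ B
    · refine M.mem_closure_of_mem ⟨⟨y, hyB⟩, mem_hitting.2 ⟨y, hy, hyE, ?_⟩, rfl⟩ hTE
      exact hB.indep.notMem_closure_sdiff_of_mem hyB
    obtain ⟨C, hCB, hC, hyC⟩ :=
      exists_isCircuit_of_mem_closure (by rwa [hB.closure_eq]) hyB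
    refine M.closure_subset_closure (fun z hz ↦ ?_) (hC.subset_closure_sdiff_singleton y hyC)
    have hzB : z ∈ B := (hCB hz.1).resolve_left hz.2
    refine ⟨⟨z, hzB⟩, mem_hitting.2 ⟨y, hy, hyE, fun hycl ↦ ?_⟩, rfl⟩
    refine hB.indep.notMem_closure_sdiff_of_mem hzB
      (M.closure_subset_closure_of_subset_closure (fun x hx ↦ ?_)
        (hC.subset_closure_sdiff_singleton z hz.1))
    obtain rfl | hxB := hCB hx.1
    · exact hycl
    · exact M.mem_closure_of_mem' ⟨hxB, hx.2⟩ (hB.subset_ground hxB)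
  · have hIE : I ⊆ M.E := by
      obtain ⟨φ, -, hφ⟩ := hI
      exact fun x hx ↦ (hφ ⟨x, hx⟩).1
    refine indep_of_forall_isCyclicFlat hIE fun F hF ↦ ?_
    refine (hI.subset inter_subset_left).encard_le.trans ?_
    rw [← h F hF, ← Subtype.val_injective.encard_image (hitting _ _)]
    refine encard_le_encard ?_
    rintro _ ⟨e, he, rfl⟩
    refine ⟨e.2, ?_⟩
    by_contra heF
    obtain ⟨x, hx, hxE, hxcl⟩ := mem_hitting.1 he
    have hspan := (M.isRkFinite_set (B ∩ F)).closure_eq_closure_of_subset_of_eRk_ge_eRk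
      inter_subset_right (by rw [(hB.indep.subset inter_subset_left).eRk_eq_encard, h F hF])
    refine hxcl (M.closure_subset_closure (subset_sdiff_singleton inter_subset_left
      fun h ↦ heF h.2) ?_)
    rw [hspan]
    exact M.mem_closure_of_mem hx.2 hF.1.subset_ground

/-- A finite matroid is fundamental transversal if and only if some base contains a basis of each
cyclic flat. -/
theorem isFundamentalTransversal_iff [M.Finite] : M.IsFundamentalTransversal ↔
    ∃ B, M.IsBase B ∧ ∀ F, M.IsCyclicFlat F → (B ∩ F).encard = M.eRk F := by
  constructor
  · rintro ⟨k, A, hA, hpriv⟩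
    choose b hb hb' using hpriv
    have h : M.Presents A := hA
    have hinj := injective_of_private hb hb'
    refine ⟨range b, h.isBase_range hb hinj, fun F hF ↦ ?_⟩
    rw [encard_range_inter hinj, ← h.encard_hitting_eq hF]
    congr 1
    ext i
    exact (h.mem_hitting_iff_of_private hb hb' hF i).symm
  · rintro ⟨B, hB, h⟩
    have : Finite B := M.ground_finite.subset hB.subset_ground
    refine (hB.presents_of_encard_inter h).isFundamentalTransversal fun e ↦
      ⟨e, ⟨hB.subset_ground e.2, hB.indep.notMem_closure_sdiff_of_mem e.2⟩, fun f hf hef ↦ hef.2 ?_⟩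
    exact M.mem_closure_of_mem' ⟨e.2, fun h ↦ hf (Subtype.ext h.symm)⟩ (hB.subset_ground e.2)

theorem IsTExpansion.isFundamentalTransversal {β : Type*} {N : Matroid β} {t : ℕ} {S : α → Set β}
    [M.Finite] (h : M.IsTExpansion t S N) (hM : M.IsFundamentalTransversal) :
    N.IsFundamentalTransversal := by
  have := h.finite
  obtain ⟨B, hB, hBF⟩ := isFundamentalTransversal_iff.1 hM
  have hE := hB.subset_ground
  refine isFundamentalTransversal_iff.2 ⟨blowUp S B, ?_, fun G hG ↦ ?_⟩
  · refine (h.indep_blowUp hB.indep).isBase_of_eRk_ge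
      (N.ground_finite.subset (h.indep_blowUp hB.indep).subset_ground) ?_
    rw [h.eRk_blowUp hE, h.eRank_eq, hB.eRk_eq_eRank]
  · obtain ⟨F, hF, rfl⟩ := (h.isCyclicFlat_iff G).1 hG
    rw [← blowUp_inter h.disjoint hE hF.1.subset_ground,
      encard_blowUp h.encard_eq h.disjoint (inter_subset_left.trans hE), hBF F hF, h.eRk_eq F hF]

end Fundamental

/-! ### Families with multiplicities divisible by `t` -/

section Divisibility

variable {X ι : Type*} [PartialOrder X]

/-- If the number of indices `j ∈ s` with `g i ≤ g j` is a multiple of `t` for all `i ∈ s`, then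
each value of `g` is taken a multiple of `t` times, and so there is a set of indices in `s`
on which each value is taken `1 / t` times as often. -/
theorem exists_finset_of_dvd (g : ι → X) {t : ℕ} (ht : 1 ≤ t) (s : Finset ι)
    (h : ∀ i ∈ s, t ∣ {j | j ∈ s ∧ g i ≤ g j}.ncard) :
    ∃ K ⊆ s, ∀ P : X → Prop,
      {i | i ∈ s ∧ P (g i)}.ncard = t * {i | i ∈ K ∧ P (g i)}.ncard := by
  classical
  simp only [← Finset.coe_filter, ncard_coe_finset] at h ⊢
  induction s using Finset.strongInduction with
  | H s ih =>
    obtain rfl | hs := s.eq_empty_or_nonempty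
    · exact ⟨∅, subset_rfl, by simp⟩
    -- remove `t` indices at which `g` takes the same maximal value
    obtain ⟨i, hi, hmax⟩ := s.exists_maximalFor g hs
    have hU : ∀ j ∈ s, g i ≤ g j → g j = g i := fun j hj hij ↦ (hmax hj hij).antisymm hij
    have hpos : 0 < (s.filter fun j ↦ g i ≤ g j).card :=
      Finset.card_pos.2 ⟨i, Finset.mem_filter.2 ⟨hi, le_rfl⟩⟩
    obtain ⟨T, hT, hTcard⟩ := Finset.exists_subset_card_eq (Nat.le_of_dvd hpos (h i hi))
    have hTs : T ⊆ s := hT.trans (Finset.filter_subset _ _)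
    have hTg : ∀ j ∈ T, g j = g i := fun j hj ↦
      hU j (hTs hj) (Finset.mem_filter.1 (hT hj)).2
    obtain ⟨k, hk⟩ : T.Nonempty := Finset.card_pos.1 (by omega)
    have hcount : ∀ (P : X → Prop), (s.filter fun j ↦ P (g j)).card =
        ((s \ T).filter fun j ↦ P (g j)).card + if P (g i) then t else 0 := by
      intro P
      have h1 : (T.filter fun j ↦ P (g j)).card = if P (g i) then t else 0 := by
        split_ifs with hP
        · rw [Finset.filter_true_of_mem fun j hj ↦ by rwa [hTg j hj], hTcard]
        · rw [Finset.filter_false_of_mem fun j hj ↦ by rwa [hTg j hj], Finset.card_empty]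
      rw [← h1, ← Finset.card_union_of_disjoint
        (Finset.disjoint_filter_filter Finset.sdiff_disjoint), ← Finset.filter_union,
        Finset.sdiff_union_of_subset hTs]
    obtain ⟨K, hK, hKP⟩ := ih (s \ T)
      (Finset.ssubset_iff_subset_ne.2 ⟨Finset.sdiff_subset, fun heq ↦ by
        have := hTs hk
        rw [← heq] at this
        exact (Finset.mem_sdiff.1 this).2 hk⟩) (fun j hj ↦ by
        have h1 := h j (Finset.sdiff_subset hj)
        rw [hcount (fun x ↦ g j ≤ x)] at h1
        refine (Nat.dvd_add_left ?_).1 h1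
        split_ifs <;> simp)
    have hkK : k ∉ K := fun h ↦ (Finset.mem_sdiff.1 (hK h)).2 hk
    refine ⟨insert k K, Finset.insert_subset (hTs hk) (hK.trans Finset.sdiff_subset), fun P ↦ ?_⟩
    rw [hcount, hKP, Finset.filter_insert, hTg k hk]
    split_ifs with hP
    · rw [Finset.card_insert_of_notMem fun h ↦ hkK (Finset.mem_filter.1 h).1, mul_add, mul_one]
    · rw [add_zero]

end Divisibility

/-! ### Descent from the `t`-expansion -/

section Descent

universe u v

variable {α : Type u} {β : Type v} {ι : Type*} [Finite ι] {M : Matroid α} [M.Finite]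
  {N : Matroid β} {t : ℕ} {S : α → Set β} {A : ι → Set β}

theorem natCast_mul_left_cancel (ht : 1 ≤ t) {a b : ℕ∞} (h : (t : ℕ∞) * a = t * b) : a = b :=
  (ENat.mul_right_strictMono (by exact_mod_cast (by omega : t ≠ 0))
    (ENat.natCast_ne_top t)).injective h

theorem natCast_mul_le_cancel (ht : 1 ≤ t) {a b : ℕ∞} (h : (t : ℕ∞) * a ≤ t * b) : a ≤ b :=
  (ENat.mul_le_mul_left_iff (by exact_mod_cast (by omega : t ≠ 0)) (ENat.natCast_ne_top t)).1 h

/-- For a presentation `A` of the `t`-expansion, let `F i` be the largest cyclic flat of `M` with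
`blowUp S (F i)` disjoint from `A i`. The number of `i` with `G ⊆ F i` is
`Nat.card ι - t * M.eRk G` for each cyclic flat `G`; so each cyclic flat
occurs a multiple of `t` times in `F`, and `K` selects `1 / t` of its occurrences. -/
theorem IsTExpansion.exists_isCyclicFlat_family (h : M.IsTExpansion t S N) (ht : 1 ≤ t)
    (hA : N.Presents A) (hdvd : t ∣ Nat.card ι) :
    ∃ (F : ι → Set α) (K : Set ι), (∀ i, M.IsCyclicFlat (F i)) ∧
      (∀ i G, M.IsCyclicFlat G → (i ∈ hitting A (blowUp S G) ↔ ¬ G ⊆ F i)) ∧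
      ∀ P : Set α → Prop, {i | P (F i)}.encard = t * {i | i ∈ K ∧ P (F i)}.encard := by
  have := h.finite
  have := Fintype.ofFinite ι
  have hex : ∀ i, ∃ F, M.IsCyclicFlat F ∧
      ∀ G, M.IsCyclicFlat G → (i ∈ hitting A (blowUp S G) ↔ ¬ G ⊆ F) := by
    intro i
    obtain ⟨L, hL, hi⟩ := hA.exists_largest_isCyclicFlat i
    obtain ⟨F, hF, rfl⟩ := (h.isCyclicFlat_iff L).1 hL
    refine ⟨F, hF, fun G hG ↦ ?_⟩
    rw [← h.blowUp_subset_blowUp_iff ht hG.1.subset_ground hF.1.subset_ground,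
      ← hi _ (h.isCyclicFlat_blowUp hG), not_not]
  choose F hF hi using hex
  obtain ⟨K, -, hK⟩ := exists_finset_of_dvd F ht Finset.univ fun i _ ↦ by
    have h1 := hA.encard_hitting_eq (h.isCyclicFlat_blowUp (hF i))
    rw [h.eRk_eq _ (hF i)] at h1
    obtain ⟨r, hr⟩ := ENat.ne_top_iff_exists.1 (eRk_ne_top_iff.2 (M.isRkFinite_set (F i)))
    rw [← hr, ← (toFinite _).cast_ncard_eq] at h1
    have h2 : {j | j ∈ Finset.univ ∧ F i ≤ F j} = (hitting A (blowUp S (F i)))ᶜ := by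
      ext j
      simp [hi j _ (hF i)]
    have h3 := ncard_add_ncard_compl (hitting A (blowUp S (F i)))
    rw [h2]
    refine (Nat.dvd_add_right ⟨r, ?_⟩).1 (h3 ▸ hdvd)
    exact_mod_cast h1
  refine ⟨F, K, hF, hi, fun P ↦ ?_⟩
  have := hK P
  rw [← (toFinite _).cast_ncard_eq, ← (toFinite _).cast_ncard_eq]
  simp only [Finset.mem_univ, true_and] at this
  exact_mod_cast this

theorem IsTExpansion.isTransversal_of_isTransversal (h : M.IsTExpansion t S N) (ht : 1 ≤ t)
    (hN : N.IsTransversal) : M.IsTransversal := by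
  have := h.finite
  obtain ⟨k, A₀, hA₀⟩ := hN
  have hA := Presents.pad (A := A₀) hA₀ ht
  set A := fun i : Fin k × Fin t ↦ {x ∈ A₀ i.1 | (i.2 : ℕ) = 0}
  obtain ⟨F, K, hF, hi, hK⟩ := h.exists_isCyclicFlat_family ht hA (by simp)
  have hcount : ∀ Y ⊆ M.E, t * (hitting (fun i : K ↦ M.E \ F i) Y).encard =
      {i | ¬ Y ⊆ F i}.encard := by
    intro Y hY
    rw [hK fun X ↦ ¬ Y ⊆ X, ← Subtype.val_injective.encard_image (hitting _ _)]
    congr 2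
    ext i
    simp only [mem_image, Subtype.exists, exists_and_right, exists_eq_right, mem_hitting,
      mem_ofPred_eq, mem_sdiff, not_subset]
    exact ⟨fun ⟨hiK, x, hx, _, hxF⟩ ↦ ⟨hiK, x, hx, hxF⟩,
      fun ⟨hiK, x, hx, hxF⟩ ↦ ⟨hiK, x, hx, hY hx, hxF⟩⟩
  refine Presents.isTransversal (A := fun i : K ↦ M.E \ F i)
    ⟨fun i ↦ sdiff_subset, fun I ↦ ⟨fun hI ↦ ?_, fun hI ↦ ?_⟩⟩
  · refine hasMatching_of_forall_encard_le fun Y hY ↦ ?_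
    have hYI := hI.subset hY
    refine natCast_mul_le_cancel ht ?_
    rw [hcount Y hYI.subset_ground, ← encard_blowUp h.encard_eq h.disjoint hYI.subset_ground]
    refine (((hA.2 _).1 (h.indep_blowUp hYI)).encard_le).trans (encard_le_encard fun i hiY hYF ↦ ?_)
    exact (hi i _ (hF i)).1 (hitting_mono (blowUp_mono hYF) hiY) subset_rfl
  · have hIE : I ⊆ M.E := by
      obtain ⟨φ, -, hφ⟩ := hI
      exact fun x hx ↦ (hφ ⟨x, hx⟩).1
    refine indep_of_forall_isCyclicFlat hIE fun G hG ↦ ?_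
    refine ((hI.subset inter_subset_left).encard_le.trans
      (encard_le_encard (hitting_mono inter_subset_right))).trans (natCast_mul_le_cancel ht ?_)
    rw [hcount G hG.1.subset_ground, ← h.eRk_eq G hG,
      ← hA.encard_hitting_eq (h.isCyclicFlat_blowUp hG)]
    exact encard_le_encard fun i hiG ↦ (hi i G hG).2 hiG

theorem IsTExpansion.isFundamentalTransversal_of_isFundamentalTransversal
    (h : M.IsTExpansion t S N) (ht : 1 ≤ t) (hN : N.IsFundamentalTransversal) :
    M.IsFundamentalTransversal := by
  have := h.finite
  obtain ⟨m, A, hA', hpriv⟩ := hN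
  have hA : N.Presents A := hA'
  choose b hb hb' using hpriv
  have hinj := injective_of_private hb hb'
  have hm : (m : ℕ∞) = t * M.eRank := by
    rw [← h.eRank_eq, ← (hA.isBase_range hb hinj).encard_eq_eRank, ← image_univ,
      hinj.encard_image]
    simp
  have hdvd : t ∣ Nat.card (Fin m) := by
    obtain ⟨r, hr⟩ := ENat.ne_top_iff_exists.1
      ((eRk_ground M) ▸ eRk_ne_top_iff.2 (M.isRkFinite_set M.E) : M.eRank ≠ ⊤)
    rw [← hr] at hm
    exact ⟨r, by simpa using (by exact_mod_cast hm : m = t * r)⟩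
  obtain ⟨F, K, hF, hi, hK⟩ := h.exists_isCyclicFlat_family ht hA hdvd
  have hbe : ∀ i, ∃ e ∈ M.E, b i ∈ S e := fun i ↦ mem_blowUp.1 (h.ground_eq ▸ hA.1 i (hb i))
  choose e he hbS using hbe
  have heG : ∀ i G, M.IsCyclicFlat G → (e i ∈ G ↔ ¬ G ⊆ F i) := fun i G hG ↦ by
    rw [← hi i G hG, hA.mem_hitting_iff_of_private hb hb' (h.isCyclicFlat_blowUp hG),
      mem_blowUp_iff h.disjoint hG.1.subset_ground (he i) (hbS i)]
  -- at most `t` of the private elements lie over one element of `M`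
  have hcard : ∀ X, {i | i ∈ K ∧ F i = X}.encard ≤ (e '' {i | F i = X}).encard := by
    intro X
    have hE : e '' {i | F i = X} ⊆ M.E := by
      rintro _ ⟨i, -, rfl⟩
      exact he i
    refine natCast_mul_le_cancel ht ?_
    rw [← hK (· = X), ← encard_blowUp h.encard_eq h.disjoint hE,
      ← hinj.encard_image {i | F i = X}]
    refine encard_le_encard ?_
    rintro _ ⟨i, hiX, rfl⟩
    exact mem_blowUp.2 ⟨e i, ⟨i, hiX, rfl⟩, hbS i⟩
  have hex : ∀ X, ∃ f : Fin m → α, (∀ i, i ∈ K ∧ F i = X → f i ∈ e '' {i | F i = X}) ∧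
      InjOn f {i | i ∈ K ∧ F i = X} := by
    intro X
    obtain hm | ⟨⟨i⟩⟩ := isEmpty_or_nonempty (Fin m)
    · exact ⟨e, fun i ↦ hm.elim i, fun i ↦ hm.elim i⟩
    · have : Nonempty α := ⟨e i⟩
      exact (toFinite _).exists_injOn_of_encard_le (hcard X)
  choose f hf hfinj using hex
  let d : Fin m → α := fun i ↦ f (F i) i
  have hd : ∀ i ∈ K, ∃ j, F j = F i ∧ e j = d i := fun i hiK ↦ hf (F i) i ⟨hiK, rfl⟩
  have hdG : ∀ i ∈ K, ∀ G, M.IsCyclicFlat G → (d i ∈ G ↔ ¬ G ⊆ F i) := fun i hiK G hG ↦ by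
    obtain ⟨j, hj, hji⟩ := hd i hiK
    rw [← hji, heG j G hG, hj]
  have hdinj : InjOn d K := by
    intro i hiK j hjK hij
    have hsub : ∀ G, M.IsCyclicFlat G → (G ⊆ F i ↔ G ⊆ F j) := fun G hG ↦ by
      rw [← not_iff_not, ← hdG i hiK G hG, ← hdG j hjK G hG, hij]
    have hFij : F i = F j :=
      ((hsub _ (hF i)).1 subset_rfl).antisymm ((hsub _ (hF j)).2 subset_rfl)
    refine hfinj (F j) ⟨hiK, hFij⟩ ⟨hjK, rfl⟩ ?_
    simpa only [d, hFij] using hij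
  have hinter : ∀ G, M.IsCyclicFlat G → (d '' K ∩ G).encard = M.eRk G := by
    intro G hG
    have h1 : d '' K ∩ G = d '' {i | i ∈ K ∧ ¬ G ⊆ F i} := by
      ext x
      constructor
      · rintro ⟨⟨i, hiK, rfl⟩, hx⟩
        exact ⟨i, ⟨hiK, (hdG i hiK G hG).1 hx⟩, rfl⟩
      · rintro ⟨i, ⟨hiK, hGi⟩, rfl⟩
        exact ⟨⟨i, hiK, rfl⟩, (hdG i hiK G hG).2 hGi⟩
    refine natCast_mul_left_cancel ht ?_
    rw [h1, (hdinj.mono fun i hi ↦ hi.1).encard_image, ← hK fun X ↦ ¬ G ⊆ X, ← h.eRk_eq G hG,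
      ← hA.encard_hitting_eq (h.isCyclicFlat_blowUp hG)]
    congr 1
    ext i
    exact (hi i G hG).symm
  have hind : M.Indep (d '' K) := by
    refine indep_of_forall_isCyclicFlat ?_ fun G hG ↦ (hinter G hG).le
    rintro _ ⟨i, hiK, rfl⟩
    obtain ⟨j, -, hji⟩ := hd i hiK
    exact hji ▸ he j
  refine isFundamentalTransversal_iff.2 ⟨d '' K, hind.isBase_of_eRk_ge (toFinite _) ?_, hinter⟩
  rw [hind.eRk_eq_encard, hdinj.encard_image]
  refine natCast_mul_le_cancel ht ?_
  have h1 := hK fun _ ↦ True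
  simp only [and_true, ofPred_true, ofPred_mem_eq, encard_univ, ENat.card_eq_coe_fintype_card,
    Fintype.card_fin] at h1
  rw [← h1, hm]

end Descent

end Matroid

theorem theorem3p9 {α : Type*} {β : Type*} (M : Matroid α) [M.Finite] (t : ℕ) (ht : 1 ≤ t)
    (S : α → Set β) (N : Matroid β) (hN : M.IsTExpansion t S N) :
    (M.IsTransversal ↔ N.IsTransversal) ∧
      (M.IsFundamentalTransversal ↔ N.IsFundamentalTransversal) := by
  refine ⟨⟨?_, hN.isTransversal_of_isTransversal ht⟩, hN.isFundamentalTransversal,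
    hN.isFundamentalTransversal_of_isFundamentalTransversal ht⟩
  rintro ⟨k, A, hA⟩
  exact (hN.presents (A := A) hA).isTransversal
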